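/- **Lemma (Finiteness and sample-continuity).** Let $X$ be a non-negative stochastic process on $\mathbb{R}^d$ with continuous sample paths and law $\mathbb{P}_X$ on the space $\mathbb{X}$ of non-negative continuous functions on $\mathbb{R}^d$ (with the topology of locally uniform convergence), let $\Psi$ be a (jointly measurable) non-negative stochastic process on $\mathbb{R}^d$, and let $\mu_Y>0$. Let $N$ be a Cox process on $\mathbb{R}^d\times(0,\infty]\times\mathbb{X}$ directed by the random measure $$\mathrm{d}\Lambda(s,u,X)=\mu_Y^{-1}\,\Psi(s)\,\mathrm{d}s\;u^{-2}\,\mathrm{d}u\;\mathrm{d}\mathbb{P}_X ,$$ that is, conditionally on $\Lambda=\lambda$, $N$ is a Poisson process with directing measure $\lambda$. Let $N=\sum_{i}\delta_{(s_i,u_i,X_i)}$ be an enumeration of its (finitely or infinitely many) points by $i=1,2,\dots$, and put $$Y(t)=\bigvee_{i} u_i X_i(t-s_i)\in[0,\infty],\qquad t\in\mathbb{R}^d .$$ For a (not necessarily compact) set $K\subset\mathbb{R}^d$ consider the conditions $$\text{(a)}\quad \mathbb{E}_\Psi\,\mathbb{E}_X\int_{\mathbb{R}^d}\sup_{t\in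 K}X(t-s)\,\Psi(s)\,\mathrm{d}s<\infty ,$$ $$\text{(b)}\quad \text{almost surely there is an } n\in\mathbb{N} \text{ with } \inf_{t\in K}\bigvee_{i\le n}u_iX_i(t-s_i)>0 .$$ 1. If (a) holds for $K$, then $\sup_{t\in K}Y(t)<\infty$ almost surely. 2. If (a) and (b) hold for $K$, then almost surely the sample path of $Y$ is continuous on $K$. 3. If (a) and (b) hold for every compact $K\subset\mathbb{R}^d$, then almost surely: $\sup_{t\in K}Y(t)<\infty$ for every compact $K$; $Y$ is continuous on $\mathbb{R}^d$; and for every compact $K$ only finitely many points of $N$ contribute to $Y$ on $K$, i.e. the set $I_K$ of all $i$ with $u_iX_i(t-s_i)=Y(t)$ for some $t\in K$ is finite, and $Y(t)=\bigvee_{i\in I_K}u_iX_i(t-s_i)$ for all $t\in K$. -/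

import Mathlib

open MeasureTheory ProbabilityTheory Set
open scoped ENNReal NNReal

noncomputable section

namespace CoxExtremal

/-! ### Point processes, Poisson processes and Cox processes -/

section PointProcess

variable {S : Type*} [MeasurableSpace S] {Ω : Type*} [MeasurableSpace Ω]

/-- The counting measure `∑_{i < m} δ_{x i}`; the number `m` of points may be infinite. -/
def pointSum (m : ℕ∞) (x : ℕ → S) : Measure S :=
  Measure.sum fun i : {i : ℕ // (i : ℕ∞) < m} => Measure.dirac (x i)

/-- A point process: a measurable map into measures (with the `σ`-algebra generated by the
evaluations `ν ↦ ν B`) which is almost surely a countable sum of unit point masses. -/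
structure IsPointProcess (N : Ω → Measure S) (P : Measure Ω) : Prop where
  measurable : Measurable N
  counting : ∀ᵐ ω ∂P, ∃ (m : ℕ∞) (x : ℕ → S), N ω = pointSum m x

/-- A Poisson process with directing measure `ν`, on the probability space `(Ω, P)`. -/
structure IsPoissonProcess (N : Ω → Measure S) (ν : Measure S) (P : Measure Ω) : Prop
    extends IsPointProcess N P where
  count_law : ∀ B : Set S, MeasurableSet B → ν B ≠ ∞ →
    HasLaw (fun ω => N ω B) ((poissonMeasure (ν B).toNNReal).map (fun n : ℕ => (n : ℝ≥0∞))) P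
  indep : ∀ (n : ℕ) (B : Fin n → Set S), (∀ j, MeasurableSet (B j)) →
    Pairwise (fun j k => Disjoint (B j) (B k)) → iIndepFun (fun j ω => N ω (B j)) P

/-- A Cox process directed by the random measure `Λ`: a point process `N` with a regular
conditional distribution given `Λ = ν` which is, for almost every value `ν` of `Λ`, the law of a
Poisson process directed by `ν`. -/
structure IsCoxProcess (N : Ω → Measure S) (Λ : Ω → Measure S) (P : Measure Ω) : Prop
    extends IsPointProcess N P where
  measurable_directing : Measurable Λ
  conditional_poisson : ∃ κ : Kernel (Measure S) (Measure S), IsMarkovKernel κ ∧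
    HasCondDistrib N Λ κ P ∧ ∀ᵐ ν ∂(P.map Λ), IsPoissonProcess id ν (κ ν)

end PointProcess

/-! ### The space of storms and the directing measure -/

/-- The space `ℝ^d`. -/
abbrev Loc (d : ℕ) : Type := EuclideanSpace ℝ (Fin d)

/-- Non-negative continuous functions on `ℝ^d`, with the topology of locally uniform
convergence (the compact-open topology). -/
abbrev Storm (d : ℕ) : Type := C(Loc d, ℝ≥0)

instance (d : ℕ) : MeasurableSpace (Storm d) := borel _

instance (d : ℕ) : BorelSpace (Storm d) := ⟨rfl⟩

/-- The interval `(0, ∞]` of severities. -/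
abbrev Severity : Type := Ioc (0 : ℝ≥0∞) ⊤

/-- The space `ℝ^d × (0, ∞] × C(ℝ^d)` of triples (centre, severity, shape). -/
abbrev Point (d : ℕ) : Type := Loc d × Severity × Storm d

/-- The measure `u⁻² du` on `(0, ∞]`; it does not charge `∞`. -/
def severityMeasure : Measure Severity :=
  ((Measure.comap Subtype.val (volume : Measure ℝ)).withDensity
    (fun u : Ioi (0 : ℝ) => ENNReal.ofReal ((u : ℝ) ^ 2)⁻¹)).map
      (fun u : Ioi (0 : ℝ) => ⟨ENNReal.ofReal (u : ℝ), ENNReal.ofReal_pos.2 u.2, le_top⟩)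

instance : SFinite severityMeasure := by
  have : SigmaFinite (Measure.comap (Subtype.val : Ioi (0 : ℝ) → ℝ) volume) := by
    apply SigmaFinite.of_map _ measurable_subtype_coe.aemeasurable
    rw [(MeasurableEmbedding.subtype_coe measurableSet_Ioi).map_comap]
    infer_instance
  unfold severityMeasure
  infer_instance

/-- The measure `μ⁻¹ ψ(s) ds u⁻² du dP_X` on the space of triples. -/
def directing {d : ℕ} (μ : ℝ≥0) (ψ : Loc d → ℝ≥0) (PX : Measure (Storm d)) :
    Measure (Point d) :=
  (μ : ℝ≥0∞)⁻¹ •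
    ((volume.withDensity (fun s => (ψ s : ℝ≥0∞))).prod (severityMeasure.prod PX))

/-! ### The extremal field -/

/-- The contribution `u X(t - s)` of the triple `(s, u, X)` at the location `t`. -/
def contribution {d : ℕ} (x : Point d) (t : Loc d) : ℝ≥0∞ :=
  (x.2.1 : ℝ≥0∞) * (x.2.2 (t - x.1) : ℝ≥0∞)

/-- The field `Y(t) = ⋁_{i < m} u_i X_i(t - s_i)` of a configuration with `m ≤ ∞` points
`x i = (s_i, u_i, X_i)`. -/
def field {d : ℕ} (m : ℕ∞) (x : ℕ → Point d) (t : Loc d) : ℝ≥0∞ :=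
  ⨆ (i : ℕ) (_ : (i : ℕ∞) < m), contribution (x i) t

/-- The maximum over (at most) the first `n` points of a configuration. -/
def partialField {d : ℕ} (m : ℕ∞) (x : ℕ → Point d) (n : ℕ) (t : Loc d) : ℝ≥0∞ :=
  ⨆ (i : ℕ) (_ : i < n) (_ : (i : ℕ∞) < m), contribution (x i) t

/-- The (indices of the) points of a configuration that contribute to the field on `K`: those
which attain the maximum at some location in `K`. -/
def contributors {d : ℕ} (m : ℕ∞) (x : ℕ → Point d) (K : Set (Loc d)) : Set ℕ :=
  {i | (i : ℕ∞) < m ∧ ∃ t ∈ K, contribution (x i) t = field m x t}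

variable {Ω : Type*} [MeasurableSpace Ω]

/-- `E_Ψ E_X ∫ sup_{t ∈ K} X(t - s) Ψ(s) ds < ∞`. -/
def IntegrabilityCondition {d : ℕ} (P : Measure Ω) (Ψ : Ω → Loc d → ℝ≥0)
    (PX : Measure (Storm d)) (K : Set (Loc d)) : Prop :=
  (∫⁻ ω, ∫⁻ X, ∫⁻ s, (⨆ t ∈ K, (X (t - s) : ℝ≥0∞) * (Ψ ω s : ℝ≥0∞)) ∂volume ∂PX ∂P) < ∞

/-- Almost surely there is an `n` with `inf_{t ∈ K} ⋁_{i < n} u_i X_i(t - s_i) > 0`. -/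
def PositivityCondition {d : ℕ} (P : Measure Ω) (M : Ω → ℕ∞) (x : Ω → ℕ → Point d)
    (K : Set (Loc d)) : Prop :=
  ∀ᵐ ω ∂P, ∃ n : ℕ, 0 < ⨅ t ∈ K, partialField (M ω) (x ω) n t

end CoxExtremal

end

namespace CoxExtremal

open Filter Topology

theorem lintegral_natCast_poissonMeasure (r : ℝ≥0) :
    ∫⁻ n : ℕ, (n : ℝ≥0∞) ∂(poissonMeasure r) = r := by
  have hsucc : ∀ n : ℕ, poissonMeasure r {n + 1} * ((n + 1 : ℕ) : ℝ≥0∞)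
      = r * poissonMeasure r {n} := by
    intro n
    rw [poissonMeasure_singleton, poissonMeasure_singleton, ← ENNReal.ofReal_natCast,
      ← ENNReal.ofReal_mul (by positivity), ← ENNReal.ofReal_coe_nnreal,
      ← ENNReal.ofReal_mul (by positivity)]
    congr 1
    rw [Nat.factorial_succ, pow_succ]
    push_cast
    field_simp
  have hone : ∑' n : ℕ, poissonMeasure r {n} = 1 := by
    simpa using (lintegral_countable' (μ := poissonMeasure r) (fun _ => (1 : ℝ≥0∞))).symm
  rw [lintegral_countable', tsum_eq_zero_add' ENNReal.summable]
  simp_rw [mul_comm _ (poissonMeasure r _), hsucc]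
  rw [ENNReal.tsum_mul_left, hone]
  simp

section Intensity

variable {S : Type*} [MeasurableSpace S] {Ω : Type*} [MeasurableSpace Ω]

theorem IsPoissonProcess.lintegral_apply {N : Ω → Measure S} {ν : Measure S} {P : Measure Ω}
    (h : IsPoissonProcess N ν P) {B : Set S} (hB : MeasurableSet B) (hν : ν B ≠ ∞) :
    ∫⁻ ω, N ω B ∂P = ν B := by
  have hlaw := h.count_law B hB hν
  calc ∫⁻ ω, N ω B ∂P = ∫⁻ y, y ∂(P.map fun ω => N ω B) :=
        (lintegral_map' measurable_id.aemeasurable hlaw.aemeasurable).symm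
    _ = ν B := by
        rw [hlaw.map_eq, lintegral_map (f := fun y => y) measurable_id .of_discrete,
          lintegral_natCast_poissonMeasure, ENNReal.coe_toNNReal hν]

theorem IsCoxProcess.lintegral_apply {N Λ : Ω → Measure S} {P : Measure Ω} [SFinite P]
    (h : IsCoxProcess N Λ P) {B : Set S} (hB : MeasurableSet B) (hΛ : ∀ᵐ ω ∂P, Λ ω B ≠ ∞) :
    ∫⁻ ω, N ω B ∂P = ∫⁻ ω, Λ ω B ∂P := by
  obtain ⟨κ, hκ, hcond, hpois⟩ := h.conditional_poisson
  have hev : Measurable fun ν : Measure S => ν B := Measure.measurable_coe hB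
  have hfin : ∀ᵐ ν ∂(P.map Λ), ν B ≠ ∞ :=
    (ae_map_iff h.measurable_directing.aemeasurable
      (hev (measurableSet_singleton ∞).compl)).2 hΛ
  calc ∫⁻ ω, N ω B ∂P = ∫⁻ p : Measure S × Measure S, p.2 B ∂(P.map fun ω => (Λ ω, N ω)) :=
        (lintegral_map (hev.comp measurable_snd)
          (h.measurable_directing.prodMk h.measurable)).symm
    _ = ∫⁻ ν, ∫⁻ n, n B ∂(κ ν) ∂(P.map Λ) := by
        rw [hcond.map_eq, Measure.lintegral_compProd
          (f := fun p : Measure S × Measure S => p.2 B) (hev.comp measurable_snd)]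
    _ = ∫⁻ ν, ν B ∂(P.map Λ) := by
        apply lintegral_congr_ae
        filter_upwards [hpois, hfin] with ν h1 h2
        exact h1.lintegral_apply hB h2
    _ = ∫⁻ ω, Λ ω B ∂P := lintegral_map hev h.measurable_directing

theorem pointSum_apply {m : ℕ∞} {x : ℕ → S} {B : Set S} (hB : MeasurableSet B) :
    pointSum m x B = {i : ℕ | (i : ℕ∞) < m ∧ x i ∈ B}.encard := by
  rw [pointSum, Measure.sum_apply _ hB]
  simp_rw [Measure.dirac_apply' _ hB]
  have := tsum_subtype {i : ℕ | (i : ℕ∞) < m} (fun i => B.indicator (1 : S → ℝ≥0∞) (x i))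
  refine this.trans ?_
  rw [← ENNReal.tsum_set_one]
  refine Eq.trans ?_ (tsum_subtype _ (fun _ => (1 : ℝ≥0∞))).symm
  congr 1
  ext i
  by_cases h1 : (i : ℕ∞) < m <;> by_cases h2 : x i ∈ B <;> simp [h1, h2]

theorem finite_setOf_mem_of_pointSum_ne_top {m : ℕ∞} {x : ℕ → S} {B : Set S}
    (hB : MeasurableSet B) (h : pointSum m x B ≠ ∞) :
    {i : ℕ | (i : ℕ∞) < m ∧ x i ∈ B}.Finite := by
  rw [pointSum_apply hB] at h
  rw [← Set.encard_ne_top_iff]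
  simpa using h

theorem notMem_of_pointSum_eq_zero {m : ℕ∞} {x : ℕ → S} {B : Set S}
    (hB : MeasurableSet B) (h : pointSum m x B = 0) {i : ℕ} (hi : (i : ℕ∞) < m) : x i ∉ B := by
  rw [pointSum_apply hB] at h
  intro hx
  have : {i : ℕ | (i : ℕ∞) < m ∧ x i ∈ B} = ∅ := by simpa using h
  exact this.subset ⟨hi, hx⟩

end Intensity

theorem severityMeasure_lt_mul_le (g c : ℝ≥0∞) (hc : c ≠ 0) (hc' : c ≠ ∞) :
    severityMeasure {u : Severity | c < (u : ℝ≥0∞) * g} ≤ g / c := by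
  rcases eq_or_ne g 0 with rfl | hg
  · simp
  rcases eq_or_ne g ∞ with rfl | hg'
  · simp [ENNReal.top_div_of_ne_top hc']
  set a : ℝ := (c / g).toReal with ha
  have hcg : c / g ≠ ∞ := ENNReal.div_ne_top hc' hg
  have ha0 : 0 < a := ENNReal.toReal_pos (ENNReal.div_ne_zero.2 ⟨hc, hg'⟩) hcg
  have hmeas : Measurable fun u : Ioi (0 : ℝ) =>
      (⟨ENNReal.ofReal (u : ℝ), ENNReal.ofReal_pos.2 u.2, le_top⟩ : Severity) := by
    fun_prop
  have hset : MeasurableSet {u : Severity | c < (u : ℝ≥0∞) * g} :=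
    measurableSet_lt measurable_const (by fun_prop)
  rw [severityMeasure, Measure.map_apply hmeas hset, withDensity_apply _ (hmeas hset)]
  have hpre : ((fun u : Ioi (0 : ℝ) =>
      (⟨ENNReal.ofReal (u : ℝ), ENNReal.ofReal_pos.2 u.2, le_top⟩ : Severity)) ⁻¹'
        {u : Severity | c < (u : ℝ≥0∞) * g}) = Subtype.val ⁻¹' Ioi a := by
    ext u
    simp only [mem_preimage, mem_ofPred_eq, mem_Ioi]
    rw [← ENNReal.div_lt_iff (Or.inl hg) (Or.inl hg'), ENNReal.lt_ofReal_iff_toReal_lt hcg]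
  rw [hpre]
  have hemb : MeasurableEmbedding (Subtype.val : Ioi (0 : ℝ) → ℝ) :=
    MeasurableEmbedding.subtype_coe measurableSet_Ioi
  rw [← hemb.lintegral_map (fun u : ℝ => ENNReal.ofReal (u ^ 2)⁻¹), ← hemb.restrict_map, hemb.map_comap, Subtype.range_val, Measure.restrict_restrict measurableSet_Ioi,
    inter_eq_left.2 (Ioi_subset_Ioi ha0.le)]
  have hpow : ∀ t ∈ Ioi a, t ^ (-2 : ℝ) = (t ^ 2)⁻¹ := by
    intro t ht
    rw [Real.rpow_neg (ha0.trans ht).le]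
    norm_num
  have hint : IntegrableOn (fun t : ℝ => (t ^ 2)⁻¹) (Ioi a) :=
    (integrableOn_Ioi_rpow_of_lt (by norm_num) ha0).congr_fun hpow measurableSet_Ioi
  rw [← ofReal_integral_eq_lintegral_ofReal hint (ae_of_all _ fun t => by positivity),
    ← setIntegral_congr_fun measurableSet_Ioi hpow,
    integral_Ioi_rpow_of_lt (by norm_num) ha0]
  have hval : -a ^ ((-2 : ℝ) + 1) / (-2 + 1) = a⁻¹ := by
    norm_num [Real.rpow_neg_one]
  rw [hval, ENNReal.ofReal_inv_of_pos ha0, ENNReal.ofReal_toReal hcg,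
    ENNReal.inv_div (Or.inl hg') (Or.inl hg)]

/-- The supremum over `K` of the shape `X` shifted to the centre `s`. -/
noncomputable def peak {d : ℕ} (K : Set (Loc d)) (s : Loc d) (X : Storm d) : ℝ≥0∞ :=
  ⨆ t ∈ K, (X (t - s) : ℝ≥0∞)

theorem measurable_peak {d : ℕ} (K : Set (Loc d)) :
    Measurable fun p : Loc d × Storm d => peak K p.1 p.2 := by
  refine LowerSemicontinuous.measurable (lowerSemicontinuous_biSup fun t _ => ?_)
  refine Continuous.lowerSemicontinuous (ENNReal.continuous_coe.comp ?_)
  fun_prop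

theorem iSup_contribution {d : ℕ} (K : Set (Loc d)) (x : Point d) :
    ⨆ t ∈ K, contribution x t = x.2.1 * peak K x.1 x.2.2 := by
  simp only [contribution, peak, ENNReal.mul_iSup]

theorem measurable_iSup_contribution {d : ℕ} (K : Set (Loc d)) :
    Measurable fun x : Point d => ⨆ t ∈ K, contribution x t := by
  simp_rw [iSup_contribution]
  have : Measurable fun x : Point d => peak K x.1 x.2.2 :=
    Measurable.comp (g := fun p : Loc d × Storm d => peak K p.1 p.2)
      (f := fun x : Point d => (x.1, x.2.2)) (measurable_peak K)
      (measurable_fst.prodMk (measurable_snd.comp measurable_snd))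
  exact (measurable_subtype_coe.comp (measurable_fst.comp measurable_snd)).mul this

theorem directing_lt_iSup_contribution_le {d : ℕ} (μ : ℝ≥0) {ψ : Loc d → ℝ≥0}
    (hψ : Measurable ψ) (PX : Measure (Storm d)) [SFinite PX] (K : Set (Loc d))
    {c : ℝ≥0∞} (hc : c ≠ 0) (hc' : c ≠ ∞) :
    directing μ ψ PX {x | c < ⨆ t ∈ K, contribution x t} ≤
      (μ : ℝ≥0∞)⁻¹ * ((∫⁻ X, ∫⁻ s, (⨆ t ∈ K, (X (t - s) : ℝ≥0∞) * (ψ s : ℝ≥0∞)) ∂volume ∂PX) / c) := by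
  have hA : MeasurableSet {x : Point d | c < ⨆ t ∈ K, contribution x t} :=
    measurableSet_lt measurable_const (measurable_iSup_contribution K)
  have hpk := measurable_peak K
  have hψ' : Measurable fun s => (ψ s : ℝ≥0∞) := by fun_prop
  rw [directing, Measure.smul_apply, smul_eq_mul, Measure.prod_apply hA]
  gcongr
  rw [lintegral_withDensity_eq_lintegral_mul _ hψ' (measurable_measure_prodMk_left hA)]
  have hsec : ∀ s : Loc d,
      (severityMeasure.prod PX) (Prod.mk s ⁻¹' {x : Point d | c < ⨆ t ∈ K, contribution x t}) ≤
        ∫⁻ X, peak K s X / c ∂PX := by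
    intro s
    rw [Measure.prod_apply_symm (measurable_prodMk_left hA)]
    refine lintegral_mono fun X => ?_
    refine le_trans (le_of_eq ?_) (severityMeasure_lt_mul_le (peak K s X) c hc hc')
    simp only [preimage_ofPred_eq, iSup_contribution]
  calc _ ≤ ∫⁻ s, (ψ s : ℝ≥0∞) * (∫⁻ X, peak K s X / c ∂PX) ∂volume :=
        lintegral_mono fun s => by
          simp only [Pi.mul_apply]
          gcongr
          exact hsec s
    _ = ∫⁻ s, ∫⁻ X, peak K s X * (ψ s : ℝ≥0∞) / c ∂PX ∂volume := by
        refine lintegral_congr fun s => ?_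
        have : Measurable fun X => peak K s X := hpk.comp measurable_prodMk_left
        rw [← lintegral_const_mul _ (by fun_prop)]
        refine lintegral_congr fun X => ?_
        rw [mul_comm, ENNReal.mul_div_right_comm]
    _ = ∫⁻ X, ∫⁻ s, peak K s X * (ψ s : ℝ≥0∞) / c ∂volume ∂PX :=
        lintegral_lintegral_swap
          (f := fun s X => peak K s X * (ψ s : ℝ≥0∞) / c)
          (by
            have h1 : Measurable fun p : Loc d × Storm d => (ψ p.1 : ℝ≥0∞) :=
              hψ'.comp measurable_fst
            exact ((hpk.mul h1).div_const c).aemeasurable)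
    _ = _ := by
        simp_rw [div_eq_mul_inv]
        have hcinv : c⁻¹ ≠ ∞ := ENNReal.inv_ne_top.2 hc
        simp_rw [lintegral_mul_const' _ _ hcinv, peak, ENNReal.iSup_mul]

theorem directing_severity_eq_top {d : ℕ} (μ : ℝ≥0) (ψ : Loc d → ℝ≥0)
    (PX : Measure (Storm d)) [SFinite PX] :
    directing μ ψ PX {x : Point d | (x.2.1 : ℝ≥0∞) = ∞} = 0 := by
  have htop : MeasurableSet {u : Severity | (u : ℝ≥0∞) = ∞} :=
    measurable_subtype_coe (measurableSet_singleton ∞)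
  have hsev : severityMeasure {u : Severity | (u : ℝ≥0∞) = ∞} = 0 := by
    rw [severityMeasure, Measure.map_apply (by fun_prop) htop]
    simp
  have hset : {x : Point d | (x.2.1 : ℝ≥0∞) = ∞} =
      univ ×ˢ ({u : Severity | (u : ℝ≥0∞) = ∞} ×ˢ univ) := by
    ext x; simp
  rw [directing, Measure.smul_apply, hset, Measure.prod_prod, Measure.prod_prod, hsev]
  simp

/-- A configuration is tame on `K` if for each positive level only finitely many contributions
exceed the level somewhere on `K`, each contribution is bounded on `K`, and all severities are
finite. -/
structure IsTameOn {d : ℕ} (m : ℕ∞) (x : ℕ → Point d) (K : Set (Loc d)) : Prop where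
  finite_exceed : ∀ c : ℝ≥0∞, c ≠ 0 →
    {i : ℕ | (i : ℕ∞) < m ∧ c < ⨆ t ∈ K, contribution (x i) t}.Finite
  bounded : ∀ i : ℕ, (i : ℕ∞) < m → ⨆ t ∈ K, contribution (x i) t < ∞
  severity_ne_top : ∀ i : ℕ, (i : ℕ∞) < m → ((x i).2.1 : ℝ≥0∞) ≠ ∞

section Deterministic

variable {d : ℕ} {m : ℕ∞} {x : ℕ → Point d} {K : Set (Loc d)}

theorem continuous_contribution {y : Point d} (hy : (y.2.1 : ℝ≥0∞) ≠ ∞) :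
    Continuous (contribution y) := by
  refine (ENNReal.continuous_const_mul hy).comp (ENNReal.continuous_coe.comp ?_)
  fun_prop

theorem partialField_le_field (n : ℕ) (t : Loc d) : partialField m x n t ≤ field m x t :=
  iSup_mono fun _ => iSup_le fun _ => le_rfl

theorem contribution_le_field {i : ℕ} (hi : (i : ℕ∞) < m) (t : Loc d) :
    contribution (x i) t ≤ field m x t :=
  le_iSup₂_of_le i hi le_rfl

theorem IsTameOn.iSup_field_lt_top (h : IsTameOn m x K) : ⨆ t ∈ K, field m x t < ∞ := by
  have hfin := h.finite_exceed 1 one_ne_zero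
  set F := {i : ℕ | (i : ℕ∞) < m ∧ 1 < ⨆ t ∈ K, contribution (x i) t} with hF
  have hlt : ⨆ i ∈ F, ⨆ t ∈ K, contribution (x i) t < ∞ := by
    rw [← hfin.coe_toFinset]
    simp only [Finset.mem_coe]
    rw [← Finset.sup_eq_iSup, Finset.sup_lt_iff ENNReal.zero_lt_top]
    exact fun i hi => h.bounded i ((hfin.mem_toFinset.1 hi).1)
  refine lt_of_le_of_lt (iSup₂_le fun t ht => iSup₂_le fun i hi => ?_)
    (max_lt ENNReal.one_lt_top hlt)
  have hle : contribution (x i) t ≤ ⨆ t ∈ K, contribution (x i) t := le_iSup₂_of_le t ht le_rfl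
  by_cases hmem : i ∈ F
  · exact hle.trans ((le_iSup₂_of_le (f := fun i (_ : i ∈ F) =>
      ⨆ t ∈ K, contribution (x i) t) i hmem le_rfl).trans (le_max_right _ _))
  · exact (hle.trans (not_lt.1 fun hc => hmem ⟨hi, hc⟩)).trans (le_max_left _ _)

theorem field_eq_iSup_of_lt {c : ℝ≥0∞} {t : Loc d} (ht : t ∈ K) (hc : c < field m x t) :
    field m x t = ⨆ i ∈ {i : ℕ | (i : ℕ∞) < m ∧ c < ⨆ t ∈ K, contribution (x i) t},
      contribution (x i) t := by
  refine le_antisymm ?_ (iSup₂_le fun i hi => contribution_le_field hi.1 t)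
  refine le_of_forall_lt fun b hb => ?_
  obtain ⟨i, hi⟩ := lt_iSup_iff.1 (max_lt hb hc)
  obtain ⟨him, hi⟩ := lt_iSup_iff.1 hi
  have hmem : c < ⨆ t ∈ K, contribution (x i) t :=
    ((le_max_right b c).trans_lt hi).trans_le (le_iSup₂_of_le t ht le_rfl)
  exact ((le_max_left b c).trans_lt hi).trans_le (le_iSup₂_of_le i ⟨him, hmem⟩ le_rfl)

theorem exists_lt_field_of_partialField_pos
    (hpos : ∃ n : ℕ, 0 < ⨅ t ∈ K, partialField m x n t) :
    ∃ c : ℝ≥0∞, c ≠ 0 ∧ ∀ t ∈ K, c < field m x t := by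
  obtain ⟨n, hn⟩ := hpos
  obtain ⟨c, hc0, hc⟩ := exists_between hn
  exact ⟨c, hc0.ne', fun t ht =>
    (hc.trans_le (iInf₂_le t ht)).trans_le (partialField_le_field n t)⟩

theorem IsTameOn.continuousOn_field (h : IsTameOn m x K)
    (hpos : ∃ n : ℕ, 0 < ⨅ t ∈ K, partialField m x n t) : ContinuousOn (field m x) K := by
  obtain ⟨c, hc0, hc⟩ := exists_lt_field_of_partialField_pos hpos
  have hfin := h.finite_exceed c hc0
  have hcont : Continuous fun t => hfin.toFinset.sup fun i => contribution (x i) t :=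
    Continuous.finset_sup_apply fun i hi =>
      continuous_contribution (h.severity_ne_top i (hfin.mem_toFinset.1 hi).1)
  refine hcont.continuousOn.congr fun t ht => ?_
  beta_reduce
  rw [field_eq_iSup_of_lt ht (hc t ht), Finset.sup_eq_iSup]
  simp only [Finite.mem_toFinset]

theorem IsTameOn.finite_contributors (h : IsTameOn m x K)
    (hpos : ∃ n : ℕ, 0 < ⨅ t ∈ K, partialField m x n t) : (contributors m x K).Finite := by
  obtain ⟨c, hc0, hc⟩ := exists_lt_field_of_partialField_pos hpos
  refine (h.finite_exceed c hc0).subset ?_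
  rintro i ⟨him, t, ht, hit⟩
  exact ⟨him, (hit ▸ hc t ht).trans_le (le_iSup₂_of_le t ht le_rfl)⟩

theorem IsTameOn.field_eq_iSup_contributors (h : IsTameOn m x K)
    (hpos : ∃ n : ℕ, 0 < ⨅ t ∈ K, partialField m x n t) {t : Loc d} (ht : t ∈ K) :
    field m x t = ⨆ i ∈ contributors m x K, contribution (x i) t := by
  obtain ⟨c, hc0, hc⟩ := exists_lt_field_of_partialField_pos hpos
  have hfin := h.finite_exceed c hc0
  have hsup : field m x t = hfin.toFinset.sup fun i => contribution (x i) t := by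
    rw [field_eq_iSup_of_lt ht (hc t ht), Finset.sup_eq_iSup]
    simp only [Finite.mem_toFinset]
  have hne : hfin.toFinset.Nonempty := by
    rw [Finset.nonempty_iff_ne_empty]
    intro he
    rw [he, Finset.sup_empty] at hsup
    exact not_lt_bot (hsup ▸ hc t ht)
  obtain ⟨i, hi, hit⟩ := Finset.exists_mem_eq_sup _ hne fun i => contribution (x i) t
  refine le_antisymm ?_ (iSup₂_le fun j hj => contribution_le_field hj.1 t)
  exact le_iSup₂_of_le i ⟨(hfin.mem_toFinset.1 hi).1, t, ht, (hsup.trans hit).symm⟩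
    (hsup.trans hit).le

theorem IsTameOn.mono {K' : Set (Loc d)} (h : IsTameOn m x K') (hK : K ⊆ K') :
    IsTameOn m x K where
  finite_exceed c hc := (h.finite_exceed c hc).subset fun _ hi =>
    ⟨hi.1, hi.2.trans_le (biSup_mono hK)⟩
  bounded i hi := (biSup_mono hK).trans_lt (h.bounded i hi)
  severity_ne_top := h.severity_ne_top

end Deterministic

theorem ae_isTameOn {d : ℕ} {Ω : Type*} [MeasurableSpace Ω]
    (P : Measure Ω) [IsProbabilityMeasure P]
    (PX : Measure (Storm d)) [IsProbabilityMeasure PX]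
    (Ψ : Ω → Loc d → ℝ≥0) (hΨ : Measurable (Function.uncurry Ψ)) (μ : ℝ≥0) (hμ : 0 < μ)
    (N : Ω → Measure (Point d)) (hN : IsCoxProcess N (fun ω => directing μ (Ψ ω) PX) P)
    (M : Ω → ℕ∞) (x : Ω → ℕ → Point d) (hx : ∀ᵐ ω ∂P, N ω = pointSum (M ω) (x ω))
    {K : Set (Loc d)} (hK : IntegrabilityCondition P Ψ PX K) :
    ∀ᵐ ω ∂P, IsTameOn (M ω) (x ω) K := by
  set I := ∫⁻ ω, ∫⁻ X, ∫⁻ s, (⨆ t ∈ K, (X (t - s) : ℝ≥0∞) * (Ψ ω s : ℝ≥0∞)) ∂volume ∂PX ∂P with hI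
  have hItop : I ≠ ∞ := ne_of_lt hK
  have hμ' : (μ : ℝ≥0∞)⁻¹ ≠ ∞ := ENNReal.inv_ne_top.2 (by exact_mod_cast hμ.ne')
  have hcoe : ∀ {B : Set (Point d)}, MeasurableSet B →
      Measurable fun ω => N ω B := fun hB => (Measure.measurable_coe hB).comp hN.measurable
  have hcoeΛ : ∀ {B : Set (Point d)}, MeasurableSet B →
      Measurable fun ω => directing μ (Ψ ω) PX B :=
    fun hB => (Measure.measurable_coe hB).comp hN.measurable_directing
  have hmeas : ∀ c : ℝ≥0∞, MeasurableSet {y : Point d | c < ⨆ t ∈ K, contribution y t} :=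
    fun c => measurableSet_lt measurable_const (measurable_iSup_contribution K)
  have hΛ : ∀ c : ℝ≥0∞, c ≠ 0 → c ≠ ∞ →
      ∫⁻ ω, directing μ (Ψ ω) PX {y | c < ⨆ t ∈ K, contribution y t} ∂P ≤
        (μ : ℝ≥0∞)⁻¹ * (I / c) := by
    intro c hc hc'
    refine (lintegral_mono fun ω =>
      directing_lt_iSup_contribution_le μ hΨ.of_uncurry_left PX K hc hc').trans_eq ?_
    rw [lintegral_const_mul' _ _ hμ']
    simp_rw [div_eq_mul_inv]
    rw [lintegral_mul_const' _ _ (ENNReal.inv_ne_top.2 hc)]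
  have hbound : ∀ c : ℝ≥0∞, c ≠ 0 → c ≠ ∞ →
      ∫⁻ ω, N ω {y | c < ⨆ t ∈ K, contribution y t} ∂P ≤ (μ : ℝ≥0∞)⁻¹ * (I / c) := by
    intro c hc hc'
    refine (hN.lintegral_apply (hmeas c) ?_).trans_le (hΛ c hc hc')
    have := ae_lt_top (hcoeΛ (hmeas c)) (ne_top_of_le_ne_top
      (ENNReal.mul_ne_top hμ' (ENNReal.div_ne_top hItop hc)) (hΛ c hc hc'))
    filter_upwards [this] with ω hω using hω.ne
  have hexceed : ∀ᵐ ω ∂P, ∀ n : ℕ,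
      N ω {y | ((n : ℝ≥0∞) + 1)⁻¹ < ⨆ t ∈ K, contribution y t} < ∞ := by
    rw [ae_all_iff]
    intro n
    have h0 : ((n : ℝ≥0∞) + 1)⁻¹ ≠ 0 := ENNReal.inv_ne_zero.2 (by finiteness)
    have h1 : ((n : ℝ≥0∞) + 1)⁻¹ ≠ ∞ := ENNReal.inv_ne_top.2 (by simp)
    exact ae_lt_top (hcoe (hmeas _)) (ne_top_of_le_ne_top
      (ENNReal.mul_ne_top hμ' (ENNReal.div_ne_top hItop h0)) (hbound _ h0 h1))
  have hmeasTop : MeasurableSet {y : Point d | ⨆ t ∈ K, contribution y t = ∞} :=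
    measurable_iSup_contribution K (measurableSet_singleton ∞)
  have hunbounded : ∀ᵐ ω ∂P, N ω {y | ⨆ t ∈ K, contribution y t = ∞} = 0 := by
    refine (lintegral_eq_zero_iff (hcoe hmeasTop)).1 ?_
    have hlim : Tendsto (fun n : ℕ => (μ : ℝ≥0∞)⁻¹ * (I / ((n : ℝ≥0∞) + 1))) atTop (𝓝 0) := by
      have h2 : Tendsto (fun n : ℕ => ((n : ℝ≥0∞) + 1)⁻¹) atTop (𝓝 0) := by
        have := (tendsto_add_atTop_iff_nat 1).2 ENNReal.tendsto_inv_nat_nhds_zero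
        simpa using this
      have h3 := ENNReal.Tendsto.const_mul (a := I) h2 (Or.inr hItop)
      have h4 := ENNReal.Tendsto.const_mul (a := (μ : ℝ≥0∞)⁻¹) h3 (Or.inr hμ')
      simpa [div_eq_mul_inv] using h4
    refine le_antisymm (ge_of_tendsto' hlim fun n => ?_) bot_le
    refine (lintegral_mono fun ω => measure_mono ?_).trans
      (hbound ((n : ℝ≥0∞) + 1) (by simp) (by finiteness))
    intro y hy
    rw [mem_ofPred_eq] at hy ⊢
    rw [hy]
    finiteness
  have hmeasSev : MeasurableSet {y : Point d | (y.2.1 : ℝ≥0∞) = ∞} :=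
    (measurable_subtype_coe.comp (measurable_fst.comp measurable_snd))
      (measurableSet_singleton ∞)
  have hseverity : ∀ᵐ ω ∂P, N ω {y | (y.2.1 : ℝ≥0∞) = ∞} = 0 := by
    refine (lintegral_eq_zero_iff (hcoe hmeasSev)).1 ?_
    rw [hN.lintegral_apply hmeasSev (by simp [directing_severity_eq_top])]
    simp [directing_severity_eq_top]
  filter_upwards [hx, hexceed, hunbounded, hseverity] with ω hω h1 h2 h3
  rw [hω] at h1 h2 h3
  refine ⟨fun c hc => ?_, fun i hi => ?_, fun i hi => ?_⟩
  · obtain ⟨n, hn⟩ := ENNReal.exists_inv_nat_lt hc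
    refine (finite_setOf_mem_of_pointSum_ne_top (hmeas _) (h1 n).ne).subset fun i hi =>
      ⟨hi.1, lt_of_le_of_lt ?_ (hn.trans hi.2)⟩
    exact ENNReal.inv_le_inv.2 le_self_add
  · exact lt_top_iff_ne_top.2 (notMem_of_pointSum_eq_zero hmeasTop h2 hi)
  · exact notMem_of_pointSum_eq_zero hmeasSev h3 hi

end CoxExtremal

theorem mainTheorem5 {d : ℕ} {Ω : Type*} [MeasurableSpace Ω]
    (P : Measure Ω) [IsProbabilityMeasure P]
    -- the law of the storm process
    (PX : Measure (CoxExtremal.Storm d)) [IsProbabilityMeasure PX]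
    -- the spatial intensity process and the scaling constant
    (Ψ : Ω → CoxExtremal.Loc d → ℝ≥0) (hΨ : Measurable (Function.uncurry Ψ))
    (μ : ℝ≥0) (hμ : 0 < μ)
    -- the Cox process and an enumeration of its points
    (N : Ω → Measure (CoxExtremal.Point d))
    (hN : CoxExtremal.IsCoxProcess N (fun ω => CoxExtremal.directing μ (Ψ ω) PX) P)
    (M : Ω → ℕ∞) (x : Ω → ℕ → CoxExtremal.Point d)
    (hx : ∀ᵐ ω ∂P, N ω = CoxExtremal.pointSum (M ω) (x ω)) :
    (∀ K : Set (CoxExtremal.Loc d), CoxExtremal.IntegrabilityCondition P Ψ PX K →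
      ∀ᵐ ω ∂P, (⨆ t ∈ K, CoxExtremal.field (M ω) (x ω) t) < ∞) ∧
    (∀ K : Set (CoxExtremal.Loc d), CoxExtremal.IntegrabilityCondition P Ψ PX K →
      CoxExtremal.PositivityCondition P M x K →
      ∀ᵐ ω ∂P, ContinuousOn (CoxExtremal.field (M ω) (x ω)) K) ∧
    ((∀ K : Set (CoxExtremal.Loc d), IsCompact K →
        CoxExtremal.IntegrabilityCondition P Ψ PX K ∧
        CoxExtremal.PositivityCondition P M x K) →
      ∀ᵐ ω ∂P,
        (∀ K : Set (CoxExtremal.Loc d), IsCompact K →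
          (⨆ t ∈ K, CoxExtremal.field (M ω) (x ω) t) < ∞) ∧
        Continuous (CoxExtremal.field (M ω) (x ω)) ∧
        (∀ K : Set (CoxExtremal.Loc d), IsCompact K →
          (CoxExtremal.contributors (M ω) (x ω) K).Finite ∧
          ∀ t ∈ K, CoxExtremal.field (M ω) (x ω) t =
            ⨆ i ∈ CoxExtremal.contributors (M ω) (x ω) K,
              CoxExtremal.contribution (x ω i) t)) := by
  have htame : ∀ {K : Set (CoxExtremal.Loc d)}, CoxExtremal.IntegrabilityCondition P Ψ PX K →
      ∀ᵐ ω ∂P, CoxExtremal.IsTameOn (M ω) (x ω) K :=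
    fun hK => CoxExtremal.ae_isTameOn P PX Ψ hΨ μ hμ N hN M x hx hK
  refine ⟨fun K hK => ?_, fun K hK hpos => ?_, fun h => ?_⟩
  · filter_upwards [htame hK] with ω hω using hω.iSup_field_lt_top
  · filter_upwards [htame hK, hpos] with ω hω hp using hω.continuousOn_field hp
  · have hball : ∀ n : ℕ, IsCompact (Metric.closedBall (0 : CoxExtremal.Loc d) n) :=
      fun n => isCompact_closedBall 0 _
    have h1 : ∀ᵐ ω ∂P, ∀ n : ℕ, CoxExtremal.IsTameOn (M ω) (x ω) (Metric.closedBall 0 n) :=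
      ae_all_iff.2 fun n => htame (h _ (hball n)).1
    have h2 : ∀ᵐ ω ∂P, ∀ n : ℕ, ∃ k : ℕ,
        0 < ⨅ t ∈ Metric.closedBall 0 (n : ℝ), CoxExtremal.partialField (M ω) (x ω) k t :=
      ae_all_iff.2 fun n => (h _ (hball n)).2
    filter_upwards [h1, h2] with ω h1 h2
    have hsub : ∀ K : Set (CoxExtremal.Loc d), IsCompact K →
        CoxExtremal.IsTameOn (M ω) (x ω) K ∧
          ∃ k : ℕ, 0 < ⨅ t ∈ K, CoxExtremal.partialField (M ω) (x ω) k t := by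
      intro K hK
      obtain ⟨r, hr⟩ := hK.isBounded.subset_closedBall 0
      obtain ⟨n, hn⟩ := exists_nat_ge r
      have hKn := hr.trans (Metric.closedBall_subset_closedBall hn)
      obtain ⟨k, hk⟩ := h2 n
      exact ⟨(h1 n).mono hKn, k, hk.trans_le (biInf_mono hKn)⟩
    refine ⟨fun K hK => (hsub K hK).1.iSup_field_lt_top, ?_, fun K hK =>
      ⟨(hsub K hK).1.finite_contributors (hsub K hK).2, fun t ht =>
        (hsub K hK).1.field_eq_iSup_contributors (hsub K hK).2 ht⟩⟩
    refine continuous_iff_continuousAt.2 fun t => ?_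
    have hcomp := isCompact_closedBall t 1
    exact ((hsub _ hcomp).1.continuousOn_field (hsub _ hcomp).2).continuousAt
      (Metric.closedBall_mem_nhds t one_pos)
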